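/- Let $\alpha,\beta,\gamma>-1$ and let $\delta\in\mathbb{R}$ with $|\delta|\neq 1$. For $n\in\mathbb{N}$ let $J_n(x;a,b,c)$ be the Big $-1$ Jacobi polynomial $$J_{n}(x;a,b,c)={}_2F_1\!\left({-\tfrac n2,\tfrac{n+a+b+2}{2}\atop \tfrac{a+1}{2}};\tfrac{1-x^2}{1-c^2}\right)+\frac{n(1-x)}{(1+c)(a+1)}\,{}_2F_1\!\left({1-\tfrac n2,\tfrac{n+a+b+2}{2}\atop \tfrac{a+3}{2}};\tfrac{1-x^2}{1-c^2}\right)\quad(n\text{ even}),$$ $$J_{n}(x;a,b,c)={}_2F_1\!\left({-\tfrac{n-1}2,\tfrac{n+a+b+1}{2}\atop \tfrac{a+1}{2}};\tfrac{1-x^2}{1-c^2}\right)-\frac{(n+a+b+1)(1-x)}{(1+c)(a+1)}\,{}_2F_1\!\left({-\tfrac{n-1}2,\tfrac{n+a+b+3}{2}\atop \tfrac{a+3}{2}};\tfrac{1-x^2}{1-c^2}\right)\quad(n\text{ odd}),$$ and for integers $0\le k\le n$ let $$\mathcal J_{n,k}(x,y)=J_{n-k}\big(y;\alpha,2k+\beta+\gamma+1,(-1)^k\delta\big)\,\rho_k(y)\,J_k\big(\tfrac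 xy;\gamma,\beta,\tfrac\delta y\big),$$ $$\rho_k(y)=y^k\Big(1-\frac{\delta^2}{y^2}\Big)^{k/2}\ (k\text{ even}),\qquad \rho_k(y)=y^k\Big(1-\frac{\delta^2}{y^2}\Big)^{(k-1)/2}\Big(1+\frac\delta y\Big)\ (k\text{ odd}),$$ for $y\ne 0$, $y^2\neq\delta^2$. Write $R_xf(x,y)=f(-x,y)$, $R_yf(x,y)=f(x,-y)$, $\mathbb I$ for the identity; in a product of operators the rightmost factor acts first, e.g. $(R_xR_y\partial_yf)(x,y)=(\partial_yf)(-x,-y)$. Let $$L_1=G_5R_xR_y\partial_y+G_6R_y\partial_y+G_7R_xR_y\partial_x+G_8R_x\partial_x+G_1R_xR_y+G_2R_x+G_3R_y-(G_1+G_2+G_3)\mathbb I,$$ where $$G_1=\frac{x[1+\beta+\gamma-y(\alpha+\beta+\gamma+2)]-\delta[y(\alpha+\gamma+1)-\gamma]}{4xy},\qquad G_2=-\frac{x[x(\beta+\gamma+1)-\beta y]+\delta(y+\gamma x)}{4x^2y},$$ $$G_3=-\delta\,\frac{x+\alpha xy-y[y(\alpha+\gamma+1)-\gamma]}{4xy^2},\qquad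 G_5=\frac{(\delta+x)(y-1)}{2x},$$ $$G_6=\frac{\delta(x-y)(y-1)}{2xy},\qquad G_7=\frac{(\delta+x)(y-1)}{2y},\qquad G_8=\frac{(\delta+x)(x-y)}{2xy},$$ and let $$L_2=\frac{2(y-x)(x+\delta)}{x}R_x\partial_x+\frac{(\gamma+\beta+1)x^2+(\delta\gamma-\beta y)x+\delta y}{x^2}(R_x-\mathbb I).$$ Then, for all $0\le k\le n$, the expression $\mathcal J_{n,k}$ is given by a nonzero polynomial in $x,y$ (again denoted $\mathcal J_{n,k}$), and this polynomial is a joint eigenfunction of $L_1$ and $L_2$: $$L_1\mathcal J_{n,k}=\mu_n\mathcal J_{n,k}\ \ (x\ne 0,\ y\neq 0),\qquad L_2\mathcal J_{n,k}=\nu_k\mathcal J_{n,k}\ \ (x\neq 0),$$ with $\mu_n=-\frac n2$ for $n$ even, $\mu_n=\frac{n+\alpha+\beta+\gamma+2}{2}$ for $n$ odd, and $\nu_k=2k$ for $k$ even, $\nu_k=-2(k+\beta+\gamma+1)$ for $k$ odd. -/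

import Mathlib

noncomputable section

namespace BigNegOneJacobi

/-- The one-variable Big `-1` Jacobi polynomial `J_n(x; a, b, c)`, in terms of the Gauss
hypergeometric function; every series that occurs with a nonzero factor terminates. -/
def bigJacobi (n : ℕ) (x a b c : ℝ) : ℝ :=
  if Even n then
    ordinaryHypergeometric (-(n : ℝ) / 2) ((n + a + b + 2) / 2) ((a + 1) / 2)
        ((1 - x ^ 2) / (1 - c ^ 2))
      + n * (1 - x) / ((1 + c) * (a + 1)) *
        ordinaryHypergeometric (1 - (n : ℝ) / 2) ((n + a + b + 2) / 2) ((a + 3) / 2)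
          ((1 - x ^ 2) / (1 - c ^ 2))
  else
    ordinaryHypergeometric (-((n : ℝ) - 1) / 2) ((n + a + b + 1) / 2) ((a + 1) / 2)
        ((1 - x ^ 2) / (1 - c ^ 2))
      - (n + a + b + 1) * (1 - x) / ((1 + c) * (a + 1)) *
        ordinaryHypergeometric (-((n : ℝ) - 1) / 2) ((n + a + b + 3) / 2) ((a + 3) / 2)
          ((1 - x ^ 2) / (1 - c ^ 2))

/-- The factor `ρ_k(y)`; the exponents `k / 2` (`k` even) and `(k - 1) / 2` (`k` odd) are
natural numbers. -/
def rho (δ : ℝ) (k : ℕ) (y : ℝ) : ℝ :=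
  if Even k then y ^ k * (1 - δ ^ 2 / y ^ 2) ^ (k / 2)
  else y ^ k * (1 - δ ^ 2 / y ^ 2) ^ ((k - 1) / 2) * (1 + δ / y)

/-- The defining expression of the two-variable Big `-1` Jacobi polynomial `𝒥_{n,k}(x, y)`
(for `k ≤ n`). It is meaningful as it stands where `y ≠ 0` and `y ^ 2 ≠ δ ^ 2`; the
singularities at the other points are removable. -/
def bivariateJacobi (α β γ δ : ℝ) (n k : ℕ) (x y : ℝ) : ℝ :=
  bigJacobi (n - k) y α (2 * k + β + γ + 1) ((-1) ^ k * δ) * rho δ k y *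
    bigJacobi k (x / y) γ β (δ / y)

/-- `P` is the polynomial `𝒥_{n,k}`: it agrees with the defining expression wherever no
denominator of the latter vanishes. (As such points are dense, there is at most one.) -/
def IsBivariateJacobi (α β γ δ : ℝ) (n k : ℕ) (P : MvPolynomial (Fin 2) ℝ) : Prop :=
  ∀ x y : ℝ, y ≠ 0 → y ^ 2 ≠ δ ^ 2 →
    MvPolynomial.eval ![x, y] P = bivariateJacobi α β γ δ n k x y

/-- The function on the plane defined by a polynomial. -/
def toFun (P : MvPolynomial (Fin 2) ℝ) (x y : ℝ) : ℝ := MvPolynomial.eval ![x, y] P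

/-- The reflection `R_x`. -/
def Rx (f : ℝ → ℝ → ℝ) : ℝ → ℝ → ℝ := fun x y => f (-x) y

/-- The reflection `R_y`. -/
def Ry (f : ℝ → ℝ → ℝ) : ℝ → ℝ → ℝ := fun x y => f x (-y)

/-- The partial derivative `∂_x`. -/
def dx (f : ℝ → ℝ → ℝ) : ℝ → ℝ → ℝ := fun x y => deriv (fun t => f t y) x

/-- The partial derivative `∂_y`. -/
def dy (f : ℝ → ℝ → ℝ) : ℝ → ℝ → ℝ := fun x y => deriv (fun t => f x t) y

def G1 (α β γ δ x y : ℝ) : ℝ :=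
  (x * (1 + β + γ - y * (α + β + γ + 2)) - δ * (y * (α + γ + 1) - γ)) / (4 * x * y)

def G2 (β γ δ x y : ℝ) : ℝ :=
  -((x * (x * (β + γ + 1) - β * y) + δ * (y + γ * x)) / (4 * x ^ 2 * y))

def G3 (α γ δ x y : ℝ) : ℝ :=
  -δ * ((x + α * x * y - y * (y * (α + γ + 1) - γ)) / (4 * x * y ^ 2))

def G5 (δ x y : ℝ) : ℝ := (δ + x) * (y - 1) / (2 * x)

def G6 (δ x y : ℝ) : ℝ := δ * (x - y) * (y - 1) / (2 * x * y)

def G7 (δ x y : ℝ) : ℝ := (δ + x) * (y - 1) / (2 * y)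

def G8 (δ x y : ℝ) : ℝ := (δ + x) * (x - y) / (2 * x * y)

/-- The operator `L₁`. In a product such as `R_x R_y ∂_y` the rightmost factor acts first. -/
def L1 (α β γ δ : ℝ) (f : ℝ → ℝ → ℝ) : ℝ → ℝ → ℝ := fun x y =>
  G5 δ x y * Rx (Ry (dy f)) x y + G6 δ x y * Ry (dy f) x y
    + G7 δ x y * Rx (Ry (dx f)) x y + G8 δ x y * Rx (dx f) x y
    + G1 α β γ δ x y * Rx (Ry f) x y + G2 β γ δ x y * Rx f x y + G3 α γ δ x y * Ry f x y
    - (G1 α β γ δ x y + G2 β γ δ x y + G3 α γ δ x y) * f x y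

/-- The operator `L₂`. -/
def L2 (β γ δ : ℝ) (f : ℝ → ℝ → ℝ) : ℝ → ℝ → ℝ := fun x y =>
  2 * (y - x) * (x + δ) / x * Rx (dx f) x y
    + ((γ + β + 1) * x ^ 2 + (δ * γ - β * y) * x + δ * y) / x ^ 2 * (Rx f x y - f x y)

/-- The eigenvalue `μ_n` of `L₁`. -/
def mu (α β γ : ℝ) (n : ℕ) : ℝ :=
  if Even n then -(n : ℝ) / 2 else (n + α + β + γ + 2) / 2

/-- The eigenvalue `ν_k` of `L₂`. -/
def nu (β γ : ℝ) (k : ℕ) : ℝ :=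
  if Even k then 2 * k else -2 * (k + β + γ + 1)

end BigNegOneJacobi

end

/-! ### Terminating Gauss series and their contiguity relations -/

namespace BigNegOneJacobi

open Polynomial

/-! Both parities of `J_n` have one shape: `F(z) - (1 - x)/(1 + c) S(z)` with `F = ₂F₁(A, B; C)` and
`S = (A/C) ₂F₁(A + 1, B; C + 1)`, where the odd case comes from the even parameters by replacing `n`
with `-(n + a + b + 1)` (`index`). The pair satisfies a first-order linear system (`Contiguous`), so
derivatives of `F` and `S` can be eliminated wherever `z ≠ 0, 1`, and every eigenvalue equation
becomes an identity of rational functions, linear in the values of `F` and `S`.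

The bivariate polynomial factors as `univ(y) * weight(y) * gPoly(x, y)`. As `L₂` acts in `x` only,
its equation concerns `gPoly` alone (`L2_identity`). For `L₁`, the terms are sorted by which of
`univ'(-y)`, `univ(-y)`, `univ(y)` they contain; in each group the action on the bivariate factor
returns a function of `y` times `gPoly(x, y)` (`G56_identity`, `L1_identity_even`/`L1_identity_odd`,
`G_sum_identity`). What remains is the one-variable eigenvalue equation in `y` (`univ_eigen`), with
second parameter `2k + β + γ + 1`.

These arguments work off finitely many curves. After denominators are cleared, both sides are
polynomials, so the equations extend to all points where the operators are defined. -/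

/-- The truncation of the Gauss hypergeometric series after `M` terms. -/
noncomputable def hypPoly (M : ℕ) (a b c : ℝ) : ℝ[X] :=
  ∑ j ∈ Finset.range M, C (ordinaryHypergeometricCoefficient a b c j) * X ^ j

lemma hypPoly_natDegree_le (M : ℕ) (a b c : ℝ) : (hypPoly M a b c).natDegree ≤ M - 1 := by
  refine natDegree_sum_le_of_forall_le _ _ fun j hj => ?_
  have := Finset.mem_range.1 hj
  exact (natDegree_C_mul_X_pow_le _ _).trans (by omega)

lemma hypPoly_coeff {M : ℕ} {a b c : ℝ}
    (h : ∀ j, M ≤ j → ordinaryHypergeometricCoefficient a b c j = 0) (j : ℕ) :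
    (hypPoly M a b c).coeff j = ordinaryHypergeometricCoefficient a b c j := by
  simp only [hypPoly, finsetSum_coeff, coeff_C_mul, coeff_X_pow, mul_ite, mul_one, mul_zero,
    Finset.sum_ite_eq, Finset.mem_range]
  split_ifs with hj
  · rfl
  · exact (h j (not_lt.1 hj)).symm

lemma ordinaryHypergeometric_eq_eval {M : ℕ} {a b c : ℝ}
    (h : ∀ j, M ≤ j → ordinaryHypergeometricCoefficient a b c j = 0) (z : ℝ) :
    ordinaryHypergeometric a b c z = (hypPoly M a b c).eval z := by
  rw [ordinaryHypergeometric_eq_tsum, hypPoly, eval_finsetSum]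
  simp only [smul_eq_mul, eval_mul, eval_C, eval_pow, eval_X]
  refine tsum_eq_sum fun j hj => ?_
  have := h j (by simpa using hj)
  simp only [ordinaryHypergeometricCoefficient] at this
  rw [this, zero_mul]

lemma ordinaryHypergeometric_symm (a b c z : ℝ) :
    ordinaryHypergeometric a b c z = ordinaryHypergeometric b a c z := by
  rw [ordinaryHypergeometric, ordinaryHypergeometric, ordinaryHypergeometricSeries_symm]

lemma hypCoeff_eq_zero_left (N : ℕ) (b c : ℝ) {j : ℕ} (hj : N < j) :
    ordinaryHypergeometricCoefficient (-(N : ℝ)) b c j = 0 := by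
  simp [ordinaryHypergeometricCoefficient,
    (ascPochhammer_eval_eq_zero_iff j (-(N : ℝ))).2 ⟨N, hj, by simp⟩]

lemma hypCoeff_eq_zero_right (N : ℕ) (a c : ℝ) {j : ℕ} (hj : N < j) :
    ordinaryHypergeometricCoefficient a (-(N : ℝ)) c j = 0 := by
  simp [ordinaryHypergeometricCoefficient,
    (ascPochhammer_eval_eq_zero_iff j (-(N : ℝ))).2 ⟨N, hj, by simp⟩]

lemma ascPochhammer_eval_succ_left (a : ℝ) (j : ℕ) :
    (ascPochhammer ℝ (j + 1)).eval a = a * (ascPochhammer ℝ j).eval (a + 1) := by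
  simp [ascPochhammer_succ_left]

/-- Both `a (a + 1)_j` and `(a)_j (a + j)` equal `(a)_{j+1}`, and likewise for `c`. -/
lemma hypCoeff_shift (a b : ℝ) {c : ℝ} (hc : 0 < c) (j : ℕ) :
    (c + j) * (a / c * ordinaryHypergeometricCoefficient (a + 1) b (c + 1) j) =
      (a + j) * ordinaryHypergeometricCoefficient a b c j := by
  have h1 := ascPochhammer_eval_succ_left a j
  have h2 := ascPochhammer_eval_succ_left c j
  rw [ascPochhammer_succ_eval] at h1 h2
  have p0 := (ascPochhammer_pos j c hc).ne'
  have p1 := (ascPochhammer_pos j (c + 1) (by linarith)).ne'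
  have p2 : (j.factorial : ℝ) ≠ 0 := by positivity
  simp only [ordinaryHypergeometricCoefficient]
  field_simp
  linear_combination (ascPochhammer ℝ j).eval b * ((-(ascPochhammer ℝ j).eval c * (c + j)) * h1
    + (a + j) * (ascPochhammer ℝ j).eval a * h2)

lemma hypCoeff_succ (a b : ℝ) {c : ℝ} (hc : 0 < c) (j : ℕ) :
    (j + 1) * ordinaryHypergeometricCoefficient a b c (j + 1) =
      (b + j) * (a / c * ordinaryHypergeometricCoefficient (a + 1) b (c + 1) j) := by
  have p1 := (ascPochhammer_pos j (c + 1) (by linarith)).ne'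
  have p2 : (j.factorial : ℝ) ≠ 0 := by positivity
  simp only [ordinaryHypergeometricCoefficient, ascPochhammer_eval_succ_left a j,
    ascPochhammer_eval_succ_left c j, ascPochhammer_succ_eval j b, Nat.factorial_succ]
  push_cast
  field_simp

/-- The contiguity relations between `F = ₂F₁(a, b; c)` and `S = (a / c) ₂F₁(a + 1, b; c + 1)`. -/
def Contiguous (a b c : ℝ) (F S : ℝ[X]) : Prop :=
  derivative F = X * derivative S + C b * S ∧
    X * derivative S + C c * S = X * derivative F + C a * F

lemma contiguous_of_coeff {a b c : ℝ} (hc : 0 < c) {F S : ℝ[X]}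
    (hF : ∀ j, F.coeff j = ordinaryHypergeometricCoefficient a b c j)
    (hS : ∀ j, S.coeff j = a / c * ordinaryHypergeometricCoefficient (a + 1) b (c + 1) j) :
    Contiguous a b c F S := by
  constructor
  · ext j
    rw [coeff_derivative, hF, coeff_add, coeff_C_mul]
    have h := hypCoeff_succ a b hc j
    rw [← hS] at h
    cases j with
    | zero => simp at h ⊢; linarith
    | succ j => rw [coeff_X_mul, coeff_derivative]; push_cast at h ⊢; linarith
  · ext j
    have h := hypCoeff_shift a b hc j
    rw [← hS, ← hF] at h
    rw [coeff_add, coeff_add, coeff_C_mul, coeff_C_mul]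
    cases j with
    | zero => simp at h ⊢; linarith
    | succ j =>
      rw [coeff_X_mul, coeff_X_mul, coeff_derivative, coeff_derivative]
      push_cast at h ⊢; linarith

/-- The index `n` for even `n`, and its reflection for odd `n`. -/
noncomputable def index (n : ℕ) (s : ℝ) : ℝ := if Even n then n else -(n + s)

/-- The two polynomials of which a Big `-1` Jacobi polynomial is composed. -/
structure IsFactorPair (n : ℕ) (a b : ℝ) (F S : ℝ[X]) : Prop where
  contiguous : Contiguous (-index n (a + b + 1) / 2) ((index n (a + b + 1) + a + b + 2) / 2)
    ((a + 1) / 2) F S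
  natDegree_left : F.natDegree ≤ n / 2
  natDegree_right : S.natDegree ≤ (n - 1) / 2
  right_of_zero : n = 0 → S = 0
  eval_zero : F.eval 0 = 1
  bigJacobi_eq : ∀ x c : ℝ, 1 + c ≠ 0 → bigJacobi n x a b c =
    F.eval ((1 - x ^ 2) / (1 - c ^ 2)) - (1 - x) / (1 + c) * S.eval ((1 - x ^ 2) / (1 - c ^ 2))

lemma exists_isFactorPair (n : ℕ) {a : ℝ} (b : ℝ) (ha : -1 < a) :
    ∃ F S : ℝ[X], IsFactorPair n a b F S := by
  have hc : 0 < (a + 1) / 2 := by linarith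
  have ha' : a + 1 ≠ 0 := by linarith
  rcases Nat.even_or_odd' n with ⟨N, rfl | rfl⟩
  · have hi : index (2 * N) (a + b + 1) = 2 * N := by simp [index]
    have e1 : -(2 * (N : ℝ)) / 2 = -(N : ℝ) := by ring
    set B : ℝ := (2 * N + a + b + 2) / 2 with hB
    set c : ℝ := (a + 1) / 2 with hcdef
    have hF : ∀ j, N + 1 ≤ j → ordinaryHypergeometricCoefficient (-(N : ℝ)) B c j = 0 :=
      fun j hj => hypCoeff_eq_zero_left N B c hj
    -- For `N = 0` the second series has upper parameter `1` and need not terminate, but its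
    -- prefactor `-N / c` vanishes.
    have hS : 0 < N → ∀ j, N ≤ j →
        ordinaryHypergeometricCoefficient (-(N : ℝ) + 1) B (c + 1) j = 0 := by
      intro hN j hj
      obtain ⟨K, rfl⟩ := Nat.exists_eq_succ_of_ne_zero hN.ne'
      have := hypCoeff_eq_zero_left K B (c + 1) (j := j) (by omega)
      convert this using 2
      push_cast; ring
    refine ⟨hypPoly (N + 1) (-(N : ℝ)) B c, C (-(N : ℝ) / c) * hypPoly N (-(N : ℝ) + 1) B (c + 1),
      ?_, ?_, ?_, ?_, ?_, ?_⟩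
    · rw [hi, e1]
      refine contiguous_of_coeff hc (hypPoly_coeff hF) fun j => ?_
      rw [coeff_C_mul]
      rcases Nat.eq_zero_or_pos N with rfl | hN
      · simp
      · rw [hypPoly_coeff (hS hN)]
    · exact (hypPoly_natDegree_le _ _ _ _).trans (by omega)
    · exact (natDegree_C_mul_le _ _).trans ((hypPoly_natDegree_le _ _ _ _).trans (by omega))
    · intro h
      obtain rfl : N = 0 := by omega
      simp
    · exact (ordinaryHypergeometric_eq_eval hF 0).symm.trans (ordinaryHypergeometric_zero _ _ _)
    · intro x d hd
      have h2 : Even (2 * N) := even_two_mul N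
      rw [bigJacobi, if_pos h2]
      push_cast
      rw [e1, ← hB, ← hcdef, ordinaryHypergeometric_eq_eval hF, eval_mul, eval_C]
      rcases Nat.eq_zero_or_pos N with rfl | hN
      · simp
      · rw [← ordinaryHypergeometric_eq_eval (hS hN), show (1 : ℝ) - 2 * N / 2 = -N + 1 by ring,
          show (a + 3) / 2 = c + 1 by rw [hcdef]; ring]
        generalize ordinaryHypergeometric (-(N : ℝ) + 1) B (c + 1) ((1 - x ^ 2) / (1 - d ^ 2)) = T
        rw [hcdef]
        field_simp
        ring
  · have ho : ¬ Even (2 * N + 1) := by simp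
    have hi : index (2 * N + 1) (a + b + 1) = -(2 * N + 1 + (a + b + 1)) := by
      simp only [index, if_neg ho]; push_cast; ring
    set A : ℝ := (2 * N + 1 + a + b + 1) / 2 with hA
    set c : ℝ := (a + 1) / 2 with hcdef
    have e1 : -(-(2 * N + 1 + (a + b + 1))) / 2 = A := by rw [hA]; ring
    have e2 : (-(2 * N + 1 + (a + b + 1)) + a + b + 2) / 2 = -(N : ℝ) := by ring
    have hF : ∀ j, N + 1 ≤ j → ordinaryHypergeometricCoefficient A (-(N : ℝ)) c j = 0 :=
      fun j hj => hypCoeff_eq_zero_right N A c hj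
    have hS : ∀ j, N + 1 ≤ j →
        ordinaryHypergeometricCoefficient (A + 1) (-(N : ℝ)) (c + 1) j = 0 :=
      fun j hj => hypCoeff_eq_zero_right N _ _ hj
    refine ⟨hypPoly (N + 1) A (-(N : ℝ)) c,
      C (A / c) * hypPoly (N + 1) (A + 1) (-(N : ℝ)) (c + 1), ?_, ?_, ?_, ?_, ?_, ?_⟩
    · rw [hi, e1, e2]
      refine contiguous_of_coeff hc (hypPoly_coeff hF) fun j => ?_
      rw [coeff_C_mul, hypPoly_coeff hS]
    · exact (hypPoly_natDegree_le _ _ _ _).trans (by omega)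
    · exact (natDegree_C_mul_le _ _).trans ((hypPoly_natDegree_le _ _ _ _).trans (by omega))
    · intro h; omega
    · exact (ordinaryHypergeometric_eq_eval hF 0).symm.trans (ordinaryHypergeometric_zero _ _ _)
    · intro x d hd
      rw [bigJacobi, if_neg ho]
      push_cast
      -- In the odd case the terminating parameter is the second one of the pair, so the upper
      -- parameters are interchanged.
      rw [show -((2 : ℝ) * N + 1 - 1) / 2 = -N by ring,
        show (2 * (N : ℝ) + 1 + a + b + 3) / 2 = A + 1 by rw [hA]; ring,
        show (a + 3) / 2 = c + 1 by rw [hcdef]; ring, ← hA, ← hcdef,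
        ordinaryHypergeometric_symm _ A, ordinaryHypergeometric_symm _ (A + 1),
        ordinaryHypergeometric_eq_eval hF, ordinaryHypergeometric_eq_eval hS, eval_mul, eval_C,
        show (2 * (N : ℝ) + 1 + a + b + 1) = 2 * A by rw [hA]; ring]
      generalize eval _ (hypPoly (N + 1) (A + 1) _ _) = T
      rw [hcdef]
      field_simp

end BigNegOneJacobi

/-! ### Rational identities behind the eigenvalue equations -/

namespace BigNegOneJacobi

/-- Adding the two relations at `z = U / V` eliminates `S1` and leaves `(1 - z) F1 = A F + (B - C)
S`; the first relation then gives `S1`. -/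
lemma solve_contiguous {A B C U V F S F1 S1 : ℝ} (hU : U ≠ 0) (hV : V ≠ 0) (hUV : V - U ≠ 0)
    (h1 : F1 = U / V * S1 + B * S) (h2 : U / V * S1 + C * S = U / V * F1 + A * F) :
    F1 = (A * F + (B - C) * S) * V / (V - U) ∧
      S1 = ((A * F + (B - C) * S) * V / (V - U) - B * S) * V / U := by
  have e1 : F1 = (A * F + (B - C) * S) * V / (V - U) := by
    rw [eq_div_iff hUV]; field_simp at h1 h2; linear_combination h1 + h2
  refine ⟨e1, ?_⟩
  rw [← e1, eq_div_iff hU]; field_simp at h1; linear_combination -h1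

/-- The coefficient of the reflection in the one-variable eigenvalue equation. -/
noncomputable def reflCoeff (α B c y : ℝ) : ℝ :=
  (y * B - y ^ 2 * (B + α + 1) - c * (1 + α * y)) / (4 * y ^ 2)

lemma one_variable_identity {α B c m y p q p1 q1 : ℝ} (hy : y ≠ 0) (hy1 : y ^ 2 ≠ 1)
    (hyc : y ^ 2 ≠ c ^ 2) (hc : c ^ 2 ≠ 1)
    (h1 : p1 = (1 - y ^ 2) / (1 - c ^ 2) * q1 + (m + α + B + 2) / 2 * q)
    (h2 : (1 - y ^ 2) / (1 - c ^ 2) * q1 + (α + 1) / 2 * q =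
      (1 - y ^ 2) / (1 - c ^ 2) * p1 + -m / 2 * p) :
    (y - 1) * (y + c) / (2 * y) *
        (p1 * (2 * y / (1 - c ^ 2)) - (1 + y) / (1 + c) * (q1 * (2 * y / (1 - c ^ 2)))
          + q / (1 + c))
      + reflCoeff α B c y *
        ((p - (1 + y) / (1 + c) * q) - (p - (1 - y) / (1 + c) * q)) =
      -m / 2 * (p - (1 - y) / (1 + c) * q) := by
  have a1 : 1 - c ^ 2 ≠ 0 := sub_ne_zero.2 hc.symm
  have a2 : 1 + c ≠ 0 := fun h => hc (by rw [show c = -1 by linarith]; norm_num)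
  have a3 : 1 - y ^ 2 ≠ 0 := sub_ne_zero.2 hy1.symm
  have a4 : y ^ 2 - c ^ 2 ≠ 0 := sub_ne_zero.2 hyc
  have a5 : 1 - c ^ 2 - (1 - y ^ 2) = y ^ 2 - c ^ 2 := by ring
  obtain ⟨e1, e2⟩ := solve_contiguous a3 a1 (by rwa [a5]) h1 h2
  rw [a5] at e1 e2
  rw [e2, e1, reflCoeff]
  field_simp
  ring

/-- The bivariate factor, up to a function of `y`, in terms of the values of its two parts. -/
def gPoly (δ F S x y : ℝ) : ℝ := (y + δ) * F - (y - x) * S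

/-- The `x`-derivative of the bivariate factor. -/
noncomputable def gPolyX (δ S F1 S1 x y : ℝ) : ℝ :=
  -2 * x / (y ^ 2 - δ ^ 2) * ((y + δ) * F1 - (y - x) * S1) + S

/-- The `y`-derivative of the bivariate factor. -/
noncomputable def gPolyY (δ F S F1 S1 x y : ℝ) : ℝ :=
  2 * y * (x ^ 2 - δ ^ 2) / (y ^ 2 - δ ^ 2) ^ 2 * ((y + δ) * F1 - (y - x) * S1) + F - S

section
variable {β γ δ κ x y F S F1 S1 : ℝ} (hx : x ≠ 0) (hy : y ≠ 0) (hyd : y ^ 2 - δ ^ 2 ≠ 0)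
    (hxd : x ^ 2 - δ ^ 2 ≠ 0) (hxy : y ^ 2 - x ^ 2 ≠ 0)
    (h1 : F1 = (y ^ 2 - x ^ 2) / (y ^ 2 - δ ^ 2) * S1 + (κ + γ + β + 2) / 2 * S)
    (h2 : (y ^ 2 - x ^ 2) / (y ^ 2 - δ ^ 2) * S1 + (γ + 1) / 2 * S =
      (y ^ 2 - x ^ 2) / (y ^ 2 - δ ^ 2) * F1 + -κ / 2 * F)
include hx hyd hxd hxy h1 h2

lemma L2_identity :
    2 * (y - x) * (x + δ) / x * gPolyX δ S F1 S1 (-x) y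
      + ((γ + β + 1) * x ^ 2 + (δ * γ - β * y) * x + δ * y) / x ^ 2 *
        (gPoly δ F S (-x) y - gPoly δ F S x y) = 2 * κ * gPoly δ F S x y := by
  have a5 : y ^ 2 - δ ^ 2 - (y ^ 2 - x ^ 2) = x ^ 2 - δ ^ 2 := by ring
  obtain ⟨e1, e2⟩ := solve_contiguous hxy hyd (by rwa [a5]) h1 h2
  rw [a5] at e1 e2
  rw [e1, e2]
  simp only [gPoly, gPolyX]
  field_simp
  ring

end

section
variable {α β γ δ k x y F S F1 S1 : ℝ} (hx : x ≠ 0) (hy : y ≠ 0) (hyd : y ^ 2 - δ ^ 2 ≠ 0)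
    (hxd : x ^ 2 - δ ^ 2 ≠ 0) (hxy : y ^ 2 - x ^ 2 ≠ 0)
include hx hy hyd hxd hxy

/-- The left side collects the terms of `L₁` carrying the undifferentiated `univ(-y)`, including the
logarithmic derivative of the weight. The factor `(-y + δ) / (y + δ)` is the ratio of the weights at
`y` and `-y`. -/
lemma L1_identity_even
    (h1 : F1 = (y ^ 2 - x ^ 2) / (y ^ 2 - δ ^ 2) * S1 + (k + γ + β + 2) / 2 * S)
    (h2 : (y ^ 2 - x ^ 2) / (y ^ 2 - δ ^ 2) * S1 + (γ + 1) / 2 * S =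
      (y ^ 2 - x ^ 2) / (y ^ 2 - δ ^ 2) * F1 + -k / 2 * F) :
    G5 δ x y * ((-k * y / (y ^ 2 - δ ^ 2) - 1 / (-y + δ)) * gPoly δ F S (-x) (-y)
          + gPolyY δ F S F1 S1 (-x) (-y))
      + G6 δ x y * ((-k * y / (y ^ 2 - δ ^ 2) - 1 / (-y + δ)) * gPoly δ F S x (-y)
          + gPolyY δ F S F1 S1 x (-y))
      + G7 δ x y * gPolyX δ S F1 S1 (-x) (-y) + G1 α β γ δ x y * gPoly δ F S (-x) (-y)
      + G3 α γ δ x y * gPoly δ F S x (-y) =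
    reflCoeff α (2 * k + β + γ + 1) δ y * gPoly δ F S x y * ((-y + δ) / (y + δ)) := by
  have a5 : y ^ 2 - δ ^ 2 - (y ^ 2 - x ^ 2) = x ^ 2 - δ ^ 2 := by ring
  obtain ⟨e1, e2⟩ := solve_contiguous hxy hyd (by rwa [a5]) h1 h2
  rw [a5] at e1 e2
  have a6 : y + δ ≠ 0 := fun h => hyd (by linear_combination (y - δ) * h)
  have a7 : -y + δ ≠ 0 := fun h => hyd (by linear_combination (-y - δ) * h)
  rw [e1, e2]
  simp only [gPoly, gPolyX, gPolyY, reflCoeff, G1, G3, G5, G6, G7, neg_sq]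
  field_simp
  ring

/-- Here the weight is even in `y`, so no ratio appears; the sign of `δ` flips, matching `(-1)^k δ`.
-/
lemma L1_identity_odd
    (h1 : F1 = (y ^ 2 - x ^ 2) / (y ^ 2 - δ ^ 2) * S1 + (-(k + β + γ + 1) + γ + β + 2) / 2 * S)
    (h2 : (y ^ 2 - x ^ 2) / (y ^ 2 - δ ^ 2) * S1 + (γ + 1) / 2 * S =
      (y ^ 2 - x ^ 2) / (y ^ 2 - δ ^ 2) * F1 + -(-(k + β + γ + 1)) / 2 * F) :
    G5 δ x y * (-(k - 1) * y / (y ^ 2 - δ ^ 2) * gPoly δ F S (-x) (-y)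
          + gPolyY δ F S F1 S1 (-x) (-y))
      + G6 δ x y * (-(k - 1) * y / (y ^ 2 - δ ^ 2) * gPoly δ F S x (-y)
          + gPolyY δ F S F1 S1 x (-y))
      + G7 δ x y * gPolyX δ S F1 S1 (-x) (-y) + G1 α β γ δ x y * gPoly δ F S (-x) (-y)
      + G3 α γ δ x y * gPoly δ F S x (-y) =
    -reflCoeff α (2 * k + β + γ + 1) (-δ) y * gPoly δ F S x y := by
  have a5 : y ^ 2 - δ ^ 2 - (y ^ 2 - x ^ 2) = x ^ 2 - δ ^ 2 := by ring
  obtain ⟨e1, e2⟩ := solve_contiguous hxy hyd (by rwa [a5]) h1 h2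
  rw [a5] at e1 e2
  rw [e1, e2]
  simp only [gPoly, gPolyX, gPolyY, reflCoeff, G1, G3, G5, G6, G7, neg_sq]
  field_simp
  ring

end

end BigNegOneJacobi

/-! ### Polynomial functions on the plane -/

namespace BigNegOneJacobi

/-- A function on the plane is polynomial. -/
def IsPoly (f : ℝ → ℝ → ℝ) : Prop := ∃ P : MvPolynomial (Fin 2) ℝ, ∀ x y, f x y = toFun P x y

lemma isPoly_toFun (P : MvPolynomial (Fin 2) ℝ) : IsPoly (toFun P) := ⟨P, fun _ _ => rfl⟩

lemma isPoly_const (r : ℝ) : IsPoly fun _ _ => r := ⟨MvPolynomial.C r, fun x y => by simp [toFun]⟩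

lemma isPoly_fst : IsPoly fun x _ => x := ⟨MvPolynomial.X 0, fun x y => by simp [toFun]⟩

lemma isPoly_snd : IsPoly fun _ y => y := ⟨MvPolynomial.X 1, fun x y => by simp [toFun]⟩

namespace IsPoly

variable {f g : ℝ → ℝ → ℝ}

lemma add (hf : IsPoly f) (hg : IsPoly g) : IsPoly fun x y => f x y + g x y := by
  obtain ⟨P, hP⟩ := hf
  obtain ⟨Q, hQ⟩ := hg
  exact ⟨P + Q, fun x y => by simp [hP, hQ, toFun]⟩

lemma mul (hf : IsPoly f) (hg : IsPoly g) : IsPoly fun x y => f x y * g x y := by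
  obtain ⟨P, hP⟩ := hf
  obtain ⟨Q, hQ⟩ := hg
  exact ⟨P * Q, fun x y => by simp [hP, hQ, toFun]⟩

lemma sub (hf : IsPoly f) (hg : IsPoly g) : IsPoly fun x y => f x y - g x y := by
  obtain ⟨P, hP⟩ := hf
  obtain ⟨Q, hQ⟩ := hg
  exact ⟨P - Q, fun x y => by simp [hP, hQ, toFun]⟩

lemma pow (hf : IsPoly f) (n : ℕ) : IsPoly fun x y => f x y ^ n := by
  obtain ⟨P, hP⟩ := hf
  exact ⟨P ^ n, fun x y => by simp [hP, toFun]⟩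

lemma div_const (hf : IsPoly f) (r : ℝ) : IsPoly fun x y => f x y / r := by
  simpa only [div_eq_mul_inv] using hf.mul (isPoly_const r⁻¹)

lemma sum {ι : Type*} (s : Finset ι) {f : ι → ℝ → ℝ → ℝ} (hf : ∀ i, IsPoly (f i)) :
    IsPoly fun x y => ∑ i ∈ s, f i x y := by
  choose P hP using hf
  exact ⟨∑ i ∈ s, P i, fun x y => by simp [hP, toFun]⟩

lemma eval (hf : IsPoly f) (p : Polynomial ℝ) : IsPoly fun x y => p.eval (f x y) := by
  simp only [Polynomial.eval_eq_sum_range]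
  exact sum _ fun i => (isPoly_const _).mul (hf.pow i)

lemma Rx (hf : IsPoly f) : IsPoly fun x y => f (-x) y := by
  obtain ⟨P, hP⟩ := hf
  obtain rfl : f = toFun P := funext₂ hP
  induction P using MvPolynomial.induction_on with
  | C r => simpa [toFun] using isPoly_const r
  | add P Q h1 h2 =>
    simpa [toFun] using (h1 fun _ _ => rfl).add (h2 fun _ _ => rfl)
  | mul_X P i h =>
    have h := h fun _ _ => rfl
    fin_cases i
    · simpa [toFun] using h.mul ((isPoly_const (-1)).mul isPoly_fst)
    · simpa [toFun] using h.mul isPoly_snd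

lemma Ry (hf : IsPoly f) : IsPoly fun x y => f x (-y) := by
  obtain ⟨P, hP⟩ := hf
  obtain rfl : f = toFun P := funext₂ hP
  induction P using MvPolynomial.induction_on with
  | C r => simpa [toFun] using isPoly_const r
  | add P Q h1 h2 =>
    simpa [toFun] using (h1 fun _ _ => rfl).add (h2 fun _ _ => rfl)
  | mul_X P i h =>
    have h := h fun _ _ => rfl
    fin_cases i
    · simpa [toFun] using h.mul isPoly_fst
    · simpa [toFun] using h.mul ((isPoly_const (-1)).mul isPoly_snd)

lemma dx (hf : IsPoly f) : IsPoly (dx f) := by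
  obtain ⟨P, hP⟩ := hf
  obtain rfl : f = toFun P := funext₂ hP
  refine ⟨MvPolynomial.pderiv 0 P, fun x y => HasDerivAt.deriv ?_⟩
  clear hP
  induction P using MvPolynomial.induction_on with
  | C r => simpa [toFun] using hasDerivAt_const x r
  | add P Q h1 h2 => simpa [toFun] using h1.fun_add h2
  | mul_X P i h =>
    fin_cases i
    · simpa [toFun, MvPolynomial.pderiv_X, add_comm, mul_comm] using h.fun_mul (hasDerivAt_id' x)
    · simpa [toFun, MvPolynomial.pderiv_X, add_comm, mul_comm] using h.fun_mul (hasDerivAt_const x y)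

lemma dy (hf : IsPoly f) : IsPoly (dy f) := by
  obtain ⟨P, hP⟩ := hf
  obtain rfl : f = toFun P := funext₂ hP
  refine ⟨MvPolynomial.pderiv 1 P, fun x y => HasDerivAt.deriv ?_⟩
  clear hP
  induction P using MvPolynomial.induction_on with
  | C r => simpa [toFun] using hasDerivAt_const y r
  | add P Q h1 h2 => simpa [toFun] using h1.fun_add h2
  | mul_X P i h =>
    fin_cases i
    · simpa [toFun, MvPolynomial.pderiv_X, add_comm, mul_comm] using h.fun_mul (hasDerivAt_const y x)
    · simpa [toFun, MvPolynomial.pderiv_X, add_comm, mul_comm] using h.fun_mul (hasDerivAt_id' y)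

/-- A polynomial function vanishes if it does so off the zero set of a nonzero one. -/
lemma eq_zero_of_generic (hf : IsPoly f) (hg : IsPoly g) {x₀ y₀ : ℝ} (h₀ : g x₀ y₀ ≠ 0)
    (h : ∀ x y, g x y ≠ 0 → f x y = 0) (x y : ℝ) : f x y = 0 := by
  obtain ⟨P, hP⟩ := hf
  obtain ⟨Q, hQ⟩ := hg
  have hv (v : Fin 2 → ℝ) : v = ![v 0, v 1] := by ext i; fin_cases i <;> rfl
  have hPQ : P * Q = 0 := by
    refine MvPolynomial.funext fun v => ?_
    rw [hv v, map_mul, map_zero]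
    by_cases hq : g (v 0) (v 1) = 0
    · rw [hQ] at hq
      exact mul_eq_zero_of_right _ hq
    · have := h _ _ hq
      rw [hP] at this
      exact mul_eq_zero_of_left this _
  rcases mul_eq_zero.1 hPQ with rfl | rfl
  · simp [hP, toFun]
  · simp [hQ, toFun] at h₀

end IsPoly

/-- The homogenization of `p` of degree `M`. -/
noncomputable def homog (M : ℕ) (p : Polynomial ℝ) (U V : ℝ) : ℝ :=
  ∑ j ∈ Finset.range (M + 1), p.coeff j * (U ^ j * V ^ (M - j))

lemma homog_eq {M : ℕ} {p : Polynomial ℝ} (hp : p.natDegree ≤ M) (U : ℝ) {V : ℝ} (hV : V ≠ 0) :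
    homog M p U V = V ^ M * p.eval (U / V) := by
  rw [homog, Polynomial.eval_eq_sum_range' (Nat.lt_succ_of_le hp), Finset.mul_sum]
  refine Finset.sum_congr rfl fun j hj => ?_
  obtain ⟨i, rfl⟩ := Nat.exists_eq_add_of_le (Nat.lt_succ_iff.1 (Finset.mem_range.1 hj))
  rw [Nat.add_sub_cancel_left, div_pow, pow_add]
  field_simp

lemma IsPoly.homog (M : ℕ) (p : Polynomial ℝ) {f g : ℝ → ℝ → ℝ} (hf : IsPoly f) (hg : IsPoly g) :
    IsPoly fun x y => homog M p (f x y) (g x y) :=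
  IsPoly.sum _ fun j => (isPoly_const _).mul ((hf.pow j).mul (hg.pow _))

/-! ### Derivatives of the factors, and the one-variable eigenvalue equation -/

/-- The argument of the hypergeometric functions in the bivariate factor. -/
noncomputable def zArg (δ x y : ℝ) : ℝ := (y ^ 2 - x ^ 2) / (y ^ 2 - δ ^ 2)

lemma hasDerivAt_zArg_fst (δ x y : ℝ) :
    HasDerivAt (fun t => zArg δ t y) (-2 * x / (y ^ 2 - δ ^ 2)) x := by
  have := (((hasDerivAt_id x).pow 2).const_sub (y ^ 2)).div_const (y ^ 2 - δ ^ 2)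
  refine this.congr_deriv ?_
  simp

lemma hasDerivAt_zArg_snd {δ y : ℝ} (x : ℝ) (hV : y ^ 2 - δ ^ 2 ≠ 0) :
    HasDerivAt (fun t => zArg δ x t) (2 * y * (x ^ 2 - δ ^ 2) / (y ^ 2 - δ ^ 2) ^ 2) y := by
  have := (((hasDerivAt_id y).pow 2).sub_const (x ^ 2)).div
    (((hasDerivAt_id y).pow 2).sub_const (δ ^ 2)) hV
  refine this.congr_deriv ?_
  simp
  ring

lemma hasDerivAt_gPoly_fst (δ x y : ℝ) (F S : Polynomial ℝ) :
    HasDerivAt (fun t => gPoly δ (F.eval (zArg δ t y)) (S.eval (zArg δ t y)) t y)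
      (gPolyX δ (S.eval (zArg δ x y)) (F.derivative.eval (zArg δ x y))
        (S.derivative.eval (zArg δ x y)) x y) x := by
  have hF := (F.hasDerivAt (zArg δ x y)).comp x (hasDerivAt_zArg_fst δ x y)
  have hS := (S.hasDerivAt (zArg δ x y)).comp x (hasDerivAt_zArg_fst δ x y)
  have := (hF.const_mul (y + δ)).sub (((hasDerivAt_id x).const_sub y).mul hS)
  refine this.congr_deriv ?_
  simp only [gPolyX, id, Function.comp]
  ring

lemma hasDerivAt_gPoly_snd {δ y : ℝ} (x : ℝ) (hV : y ^ 2 - δ ^ 2 ≠ 0) (F S : Polynomial ℝ) :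
    HasDerivAt (fun t => gPoly δ (F.eval (zArg δ x t)) (S.eval (zArg δ x t)) x t)
      (gPolyY δ (F.eval (zArg δ x y)) (S.eval (zArg δ x y)) (F.derivative.eval (zArg δ x y))
        (S.derivative.eval (zArg δ x y)) x y) y := by
  have hF := (F.hasDerivAt (zArg δ x y)).comp y (hasDerivAt_zArg_snd x hV)
  have hS := (S.hasDerivAt (zArg δ x y)).comp y (hasDerivAt_zArg_snd x hV)
  have := (((hasDerivAt_id y).add_const δ).mul hF).sub (((hasDerivAt_id y).sub_const x).mul hS)
  refine this.congr_deriv ?_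
  simp only [gPolyY, id, Function.comp]
  ring

/-- The univariate factor. -/
noncomputable def univ (c : ℝ) (p q : Polynomial ℝ) (y : ℝ) : ℝ :=
  p.eval ((1 - y ^ 2) / (1 - c ^ 2)) - (1 - y) / (1 + c) * q.eval ((1 - y ^ 2) / (1 - c ^ 2))

/-- The derivative of the univariate factor. -/
noncomputable def univDeriv (c : ℝ) (p q : Polynomial ℝ) (y : ℝ) : ℝ :=
  p.derivative.eval ((1 - y ^ 2) / (1 - c ^ 2)) * (-2 * y / (1 - c ^ 2))
    - (1 - y) / (1 + c) *
      (q.derivative.eval ((1 - y ^ 2) / (1 - c ^ 2)) * (-2 * y / (1 - c ^ 2)))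
    + q.eval ((1 - y ^ 2) / (1 - c ^ 2)) / (1 + c)

lemma hasDerivAt_univ (c : ℝ) (p q : Polynomial ℝ) (y : ℝ) :
    HasDerivAt (univ c p q) (univDeriv c p q y) y := by
  have hw : HasDerivAt (fun t : ℝ => (1 - t ^ 2) / (1 - c ^ 2)) (-2 * y / (1 - c ^ 2)) y := by
    refine (((hasDerivAt_id y).pow 2).const_sub 1 |>.div_const (1 - c ^ 2)).congr_deriv ?_
    simp
  have hp := (p.hasDerivAt ((1 - y ^ 2) / (1 - c ^ 2))).comp y hw
  have hq := (q.hasDerivAt ((1 - y ^ 2) / (1 - c ^ 2))).comp y hw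
  refine (hp.sub ((((hasDerivAt_id y).const_sub 1).div_const (1 + c)).mul hq)).congr_deriv ?_
  simp only [univDeriv, id, Function.comp]
  ring

lemma univ_eigen {α B c m y : ℝ} {p q : Polynomial ℝ}
    (h : Contiguous (-m / 2) ((m + α + B + 2) / 2) ((α + 1) / 2) p q) (hy : y ≠ 0)
    (hy1 : y ^ 2 ≠ 1) (hyc : y ^ 2 ≠ c ^ 2) (hc : c ^ 2 ≠ 1) :
    (y - 1) * (y + c) / (2 * y) * univDeriv c p q (-y)
      + reflCoeff α B c y * (univ c p q (-y) - univ c p q y) = -m / 2 * univ c p q y := by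
  have h1 := congrArg (Polynomial.eval ((1 - y ^ 2) / (1 - c ^ 2))) h.1
  have h2 := congrArg (Polynomial.eval ((1 - y ^ 2) / (1 - c ^ 2))) h.2
  simp only [Polynomial.eval_add, Polynomial.eval_mul, Polynomial.eval_X, Polynomial.eval_C]
    at h1 h2
  have := one_variable_identity hy hy1 hyc hc h1 h2
  simp only [univ, univDeriv, neg_sq]
  linear_combination this

/-- The `y`-dependent weight of the bivariate factor. -/
noncomputable def weight (δ : ℝ) (k : ℕ) (y : ℝ) : ℝ :=
  if Even k then (y ^ 2 - δ ^ 2) ^ (k / 2) / (y + δ) else (y ^ 2 - δ ^ 2) ^ (k / 2)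

/-- The logarithmic derivative of the weight. -/
noncomputable def weightLogDeriv (δ : ℝ) (k : ℕ) (y : ℝ) : ℝ :=
  if Even k then k * y / (y ^ 2 - δ ^ 2) - 1 / (y + δ) else (k - 1) * y / (y ^ 2 - δ ^ 2)

lemma add_ne_zero_of_sq {δ y : ℝ} (hV : y ^ 2 - δ ^ 2 ≠ 0) : y + δ ≠ 0 :=
  fun h => hV (by linear_combination (y - δ) * h)

lemma hasDerivAt_weight {δ y : ℝ} (k : ℕ) (hV : y ^ 2 - δ ^ 2 ≠ 0) :
    HasDerivAt (weight δ k) (weight δ k y * weightLogDeriv δ k y) y := by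
  have hpow (N : ℕ) : HasDerivAt (fun t : ℝ => (t ^ 2 - δ ^ 2) ^ N)
      ((y ^ 2 - δ ^ 2) ^ N * (2 * N * y / (y ^ 2 - δ ^ 2))) y := by
    refine ((((hasDerivAt_id y).pow 2).sub_const (δ ^ 2)).pow N).congr_deriv ?_
    cases N with
    | zero => simp
    | succ N => simp; field_simp; ring
  have hy := add_ne_zero_of_sq hV
  rcases Nat.even_or_odd' k with ⟨N, rfl | rfl⟩
  · have e : weight δ (2 * N) = fun t => (t ^ 2 - δ ^ 2) ^ N / (t + δ) := by
      ext t; simp [weight]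
    rw [e]
    refine ((hpow N).div ((hasDerivAt_id y).add_const δ) hy).congr_deriv ?_
    simp [weightLogDeriv]
    field_simp
  · have e : weight δ (2 * N + 1) = fun t => (t ^ 2 - δ ^ 2) ^ N := by
      ext t; simp [weight, show (2 * N + 1) / 2 = N by omega]
    rw [e]
    refine (hpow N).congr_deriv ?_
    simp [weightLogDeriv]

end BigNegOneJacobi

/-! ### The operators on the factored form -/

namespace BigNegOneJacobi

/-- The part `G₈ R_x ∂_x + G₂ (R_x - 𝕀)` of `L₁` is `-L₂ / (4y)`, and `G₁ + G₃` does not depend on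
`x`. -/
lemma G_sum_identity {α β γ δ κ x y g gm X : ℝ} (hx : x ≠ 0) (hy : y ≠ 0)
    (h : 2 * (y - x) * (x + δ) / x * X
      + ((γ + β + 1) * x ^ 2 + (δ * γ - β * y) * x + δ * y) / x ^ 2 * (gm - g) = 2 * κ * g) :
    G8 δ x y * X + G2 β γ δ x y * gm - (G1 α β γ δ x y + G2 β γ δ x y + G3 α γ δ x y) * g =
      (-(2 * κ) / (4 * y) - (1 + β + γ - y * (α + β + γ + 2)) / (4 * y)
        + δ * (1 + α * y) / (4 * y ^ 2)) * g := by
  have e : G8 δ x y * X + G2 β γ δ x y * (gm - g) = -1 / (4 * y) * (2 * κ * g) := by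
    rw [← h, G8, G2]
    field_simp
    ring
  have e' : G1 α β γ δ x y + G3 α γ δ x y = (1 + β + γ - y * (α + β + γ + 2)) / (4 * y)
      - δ * (1 + α * y) / (4 * y ^ 2) := by
    rw [G1, G3]
    field_simp
    ring
  linear_combination e - g * e'

/-- This is the coefficient of `univ'(-y)`: the two reflected copies recombine into `gPoly` at `(x,
y)`. -/
lemma G56_identity {δ F S x y : ℝ} (hx : x ≠ 0) (hy : y ≠ 0) :
    G5 δ x y * gPoly δ F S (-x) (-y) + G6 δ x y * gPoly δ F S x (-y) =
      (y - 1) * (-y + δ) / (2 * y) * gPoly δ F S x y := by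
  simp only [gPoly, G5, G6]
  field_simp
  ring

lemma zArg_neg_fst (δ x y : ℝ) : zArg δ (-x) y = zArg δ x y := by simp [zArg]

lemma zArg_neg_snd (δ x y : ℝ) : zArg δ x (-y) = zArg δ x y := by simp [zArg]

section

variable {c δ : ℝ} {k : ℕ} {p q F S : Polynomial ℝ} {T : ℝ → ℝ → ℝ}
  (hT : ∀ x y, y ^ 2 - δ ^ 2 ≠ 0 → T x y = univ c p q y * (weight δ k y *
    gPoly δ (F.eval (zArg δ x y)) (S.eval (zArg δ x y)) x y))
include hT

lemma dx_eq {x y : ℝ} (hV : y ^ 2 - δ ^ 2 ≠ 0) :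
    dx T x y = univ c p q y * (weight δ k y * gPolyX δ (S.eval (zArg δ x y))
      (F.derivative.eval (zArg δ x y)) (S.derivative.eval (zArg δ x y)) x y) := by
  refine HasDerivAt.deriv ?_
  rw [show (fun t => T t y) = _ from funext fun t => hT t y hV]
  exact ((hasDerivAt_gPoly_fst δ x y F S).const_mul _).const_mul _

lemma dy_eq {x y : ℝ} (hV : y ^ 2 - δ ^ 2 ≠ 0) :
    dy T x y = univDeriv c p q y * (weight δ k y *
        gPoly δ (F.eval (zArg δ x y)) (S.eval (zArg δ x y)) x y)
      + univ c p q y * (weight δ k y * (weightLogDeriv δ k y *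
          gPoly δ (F.eval (zArg δ x y)) (S.eval (zArg δ x y)) x y
        + gPolyY δ (F.eval (zArg δ x y)) (S.eval (zArg δ x y))
          (F.derivative.eval (zArg δ x y)) (S.derivative.eval (zArg δ x y)) x y)) := by
  refine HasDerivAt.deriv ?_
  have hev : ∀ᶠ t in nhds y, t ^ 2 - δ ^ 2 ≠ 0 :=
    (show Continuous fun t : ℝ => t ^ 2 - δ ^ 2 by fun_prop).continuousAt.eventually_ne hV
  have := (hasDerivAt_univ c p q y).fun_mul
    ((hasDerivAt_weight k hV).fun_mul (hasDerivAt_gPoly_snd x hV F S))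
  refine (this.congr_of_eventuallyEq (hev.mono fun t ht => hT x t ht)).congr_deriv ?_
  ring

variable {β γ x y : ℝ}
  (hFS : Contiguous (-index k (γ + β + 1) / 2) ((index k (γ + β + 1) + γ + β + 2) / 2)
    ((γ + 1) / 2) F S) (hx : x ≠ 0) (hV : y ^ 2 - δ ^ 2 ≠ 0)
  (hxd : x ^ 2 - δ ^ 2 ≠ 0) (hxy : y ^ 2 - x ^ 2 ≠ 0)
include hFS hx hV hxd hxy

lemma L2_generic : L2 β γ δ T x y = 2 * index k (γ + β + 1) * T x y := by
  have h1 := congrArg (Polynomial.eval (zArg δ x y)) hFS.1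
  have h2 := congrArg (Polynomial.eval (zArg δ x y)) hFS.2
  simp only [Polynomial.eval_add, Polynomial.eval_mul, Polynomial.eval_X, Polynomial.eval_C]
    at h1 h2
  have h := L2_identity hx hV hxd hxy h1 h2
  simp only [L2, Rx, dx_eq hT hV, hT _ _ hV, zArg_neg_fst]
  linear_combination univ c p q y * weight δ k y * h

lemma L1_generic {α : ℝ} {n : ℕ} (hkn : k ≤ n) (hc : c = (-1) ^ k * δ)
    (hpq : Contiguous (-index (n - k) (α + (2 * k + β + γ + 1) + 1) / 2)
      ((index (n - k) (α + (2 * k + β + γ + 1) + 1) + α + (2 * k + β + γ + 1) + 2) / 2)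
      ((α + 1) / 2) p q)
    (hδ : δ ^ 2 ≠ 1) (hy : y ≠ 0) (hy1 : y ^ 2 ≠ 1) :
    L1 α β γ δ T x y = mu α β γ n * T x y := by
  have h1 := congrArg (Polynomial.eval (zArg δ x y)) hFS.1
  have h2 := congrArg (Polynomial.eval (zArg δ x y)) hFS.2
  simp only [Polynomial.eval_add, Polynomial.eval_mul, Polynomial.eval_X, Polynomial.eval_C]
    at h1 h2
  have hE := G_sum_identity (α := α) hx hy (L2_identity hx hV hxd hxy h1 h2)
  have hA := G56_identity (δ := δ) (F := F.eval (zArg δ x y)) (S := S.eval (zArg δ x y)) hx hy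
  have hV' : (-y) ^ 2 - δ ^ 2 ≠ 0 := by rwa [neg_sq]
  have hc2 : c ^ 2 = δ ^ 2 := by rw [hc, mul_pow, ← pow_mul, mul_comm k, pow_mul]; simp
  have hK := univ_eigen hpq hy hy1 (by rw [hc2]; exact sub_ne_zero.1 hV) (hc2 ▸ hδ)
  -- Expressing `μ_n` through the index of the univariate factor removes the case split on the
  -- parity of `n - k`.
  have hmu : mu α β γ n = if Even k then -(index (n - k) (α + (2 * k + β + γ + 1) + 1) + k) / 2
      else (index (n - k) (α + (2 * k + β + γ + 1) + 1) + k + α + β + γ + 2) / 2 := by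
    obtain ⟨m, rfl⟩ := Nat.exists_eq_add_of_le hkn
    rw [Nat.add_sub_cancel_left]
    by_cases hk : Even k <;> by_cases hm : Even m <;>
      simp [mu, index, hk, hm, Nat.even_add] <;> ring
  simp only [L1, Rx, Ry, dx_eq hT hV, dx_eq hT hV', dy_eq hT hV', hT _ _ hV, hT _ _ hV',
    zArg_neg_fst, zArg_neg_snd]
  rw [hmu]
  generalize index (n - k) (α + (2 * k + β + γ + 1) + 1) = m at *
  have hs := add_ne_zero_of_sq hV
  have hs' := add_ne_zero_of_sq hV'
  by_cases hk : Even k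
  · have hi : index k (γ + β + 1) = k := by simp [index, hk]
    rw [hi] at h1 h2 hE
    have hB := L1_identity_even (α := α) hx hy hV hxd hxy h1 h2
    have hw : weight δ k (-y) * (-y + δ) = weight δ k y * (y + δ) := by
      simp only [weight, if_pos hk, neg_sq]
      field_simp
    have hl : weightLogDeriv δ k (-y) = -k * y / (y ^ 2 - δ ^ 2) - 1 / (-y + δ) := by
      simp only [weightLogDeriv, if_pos hk, neg_sq]
      ring
    have hcδ : c = δ := by simp [hc, hk.neg_one_pow]
    rw [hcδ] at hK ⊢
    rw [hl, if_pos hk]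
    have hr : -(2 * (k : ℝ)) / (4 * y) - (1 + β + γ - y * (α + β + γ + 2)) / (4 * y)
        + δ * (1 + α * y) / (4 * y ^ 2) = -reflCoeff α (2 * k + β + γ + 1) δ y - k / 2 := by
      rw [reflCoeff]
      field_simp
      ring
    rw [hr] at hE
    have hw2 : weight δ k (-y) * ((-y + δ) / (y + δ)) = weight δ k y := by
      rw [← mul_div_assoc, hw, mul_div_cancel_right₀ _ hs]
    generalize gPoly δ _ _ x y = g at *
    -- The three groups of terms plus the one-variable equation; `hw` and `hw2` convert the weight
    -- at `-y` into that at `y`.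
    linear_combination univDeriv δ p q (-y) * weight δ k (-y) * hA
      + univ δ p q (-y) * weight δ k (-y) * hB + univ δ p q y * weight δ k y * hE
      + weight δ k y * g * hK
      + univDeriv δ p q (-y) * g * (y - 1) / (2 * y) * hw
      + univ δ p q (-y) * g * reflCoeff α (2 * k + β + γ + 1) δ y * hw2
  · have hi : index k (γ + β + 1) = -(k + β + γ + 1) := by simp [index, hk]; ring
    rw [hi] at h1 h2 hE
    have hB := L1_identity_odd (α := α) hx hy hV hxd hxy h1 h2
    have hw : weight δ k (-y) = weight δ k y := by simp [weight, hk]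
    have hl : weightLogDeriv δ k (-y) = -(k - 1) * y / (y ^ 2 - δ ^ 2) := by
      simp only [weightLogDeriv, if_neg hk, neg_sq]
      ring
    have hcδ : c = -δ := by simp [hc, (Nat.not_even_iff_odd.1 hk).neg_one_pow]
    rw [hcδ] at hK ⊢
    rw [hl, hw, if_neg hk]
    have hr : -(2 * -((k : ℝ) + β + γ + 1)) / (4 * y)
        - (1 + β + γ - y * (α + β + γ + 2)) / (4 * y) + δ * (1 + α * y) / (4 * y ^ 2) =
        reflCoeff α (2 * k + β + γ + 1) (-δ) y + (k + α + β + γ + 2) / 2 := by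
      rw [reflCoeff]
      field_simp
      ring
    rw [hr] at hE
    generalize gPoly δ _ _ x y = g at *
    linear_combination univDeriv (-δ) p q (-y) * weight δ k y * hA
      + univ (-δ) p q (-y) * weight δ k y * hB + univ (-δ) p q y * weight δ k y * hE
      - weight δ k y * g * hK

end

/-! ### Polynomiality and agreement with the defining expression -/

/-- The powers of `y² - δ²` in the weight clear the denominators of `F` and `S`, by their degree
bounds. For even `k` the divisor `y + δ` cancels against `gPoly` in the `F` term, and in the `S`
term against a spare factor `y² - δ²`, as `S` has smaller degree. -/
lemma exists_polynomial {c δ a b : ℝ} {k : ℕ} (p q : Polynomial ℝ) {F S : Polynomial ℝ}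
    (h : IsFactorPair k a b F S) : ∃ P : MvPolynomial (Fin 2) ℝ, ∀ x y, y ^ 2 - δ ^ 2 ≠ 0 →
      toFun P x y = univ c p q y * (weight δ k y *
        gPoly δ (F.eval (zArg δ x y)) (S.eval (zArg δ x y)) x y) := by
  have hX := isPoly_fst
  have hY := isPoly_snd
  have hu : IsPoly fun _ y => univ c p q y := by
    have hw : IsPoly fun _ y => (1 - y ^ 2) / (1 - c ^ 2) :=
      ((isPoly_const 1).sub (hY.pow 2)).div_const _
    exact (hw.eval p).sub ((((isPoly_const 1).sub hY).div_const _).mul (hw.eval q))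
  have hUU : IsPoly fun x y => y ^ 2 - x ^ 2 := (hY.pow 2).sub (hX.pow 2)
  have hVV : IsPoly fun _ y => y ^ 2 - δ ^ 2 := (hY.pow 2).sub (isPoly_const _)
  suffices hg : ∃ g, IsPoly g ∧ ∀ x y, y ^ 2 - δ ^ 2 ≠ 0 → g x y = weight δ k y *
      gPoly δ (F.eval (zArg δ x y)) (S.eval (zArg δ x y)) x y by
    obtain ⟨g, hg, hg'⟩ := hg
    obtain ⟨P, hP⟩ := hu.mul hg
    exact ⟨P, fun x y hV => (hP x y).symm.trans (congrArg _ (hg' x y hV))⟩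
  by_cases hk : Even k
  · refine ⟨fun x y => homog (k / 2) F (y ^ 2 - x ^ 2) (y ^ 2 - δ ^ 2)
      - (y - x) * ((y - δ) * homog ((k - 1) / 2) S (y ^ 2 - x ^ 2) (y ^ 2 - δ ^ 2)),
      (hUU.homog _ _ hVV).sub ((hY.sub hX).mul ((hY.sub (isPoly_const δ)).mul
        (hUU.homog _ _ hVV))), fun x y hV => ?_⟩
    have hs := add_ne_zero_of_sq hV
    have hz : (y ^ 2 - x ^ 2) / (y ^ 2 - δ ^ 2) = zArg δ x y := rfl
    simp only [homog_eq h.natDegree_left _ hV, homog_eq h.natDegree_right _ hV, weight,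
      if_pos hk, gPoly, hz]
    obtain ⟨N, rfl⟩ := hk.two_dvd
    cases N with
    -- For `k = 0` no spare factor exists, so `S = 0` is needed.
    | zero => simp [h.right_of_zero rfl]; field_simp
    | succ N =>
      rw [show 2 * (N + 1) / 2 = N + 1 by omega, show (2 * (N + 1) - 1) / 2 = N by omega]
      field_simp
      ring
  · refine ⟨fun x y => (y + δ) * homog (k / 2) F (y ^ 2 - x ^ 2) (y ^ 2 - δ ^ 2)
      - (y - x) * homog ((k - 1) / 2) S (y ^ 2 - x ^ 2) (y ^ 2 - δ ^ 2),
      ((hY.add (isPoly_const δ)).mul (hUU.homog _ _ hVV)).sub ((hY.sub hX).mul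
        (hUU.homog _ _ hVV)), fun x y hV => ?_⟩
    have e : (k - 1) / 2 = k / 2 := by
      have := Nat.odd_iff.1 (Nat.not_even_iff_odd.1 hk)
      omega
    have h3 := h.natDegree_right
    rw [e] at h3
    have hz : (y ^ 2 - x ^ 2) / (y ^ 2 - δ ^ 2) = zArg δ x y := rfl
    simp only [e, homog_eq h.natDegree_left _ hV, homog_eq h3 _ hV, weight,
      if_neg hk, gPoly, hz]
    ring

lemma rho_mul_bigJacobi {δ a b x y : ℝ} {k : ℕ} {F S : Polynomial ℝ}
    (h : IsFactorPair k a b F S) (hy : y ≠ 0) (hV : y ^ 2 - δ ^ 2 ≠ 0) :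
    rho δ k y * bigJacobi k (x / y) a b (δ / y) =
      weight δ k y * gPoly δ (F.eval (zArg δ x y)) (S.eval (zArg δ x y)) x y := by
  have hs := add_ne_zero_of_sq hV
  have h0 : 1 + δ / y = (y + δ) / y := by field_simp
  have h1 : 1 - δ ^ 2 / y ^ 2 = (y ^ 2 - δ ^ 2) / y ^ 2 := by field_simp
  have hz : (1 - (x / y) ^ 2) / (1 - (δ / y) ^ 2) = zArg δ x y := by
    rw [div_pow δ, h1, zArg]
    field_simp
  rw [h.bigJacobi_eq _ _ (by rw [h0]; positivity), hz, rho, weight, gPoly, h0, h1]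
  rcases Nat.even_or_odd' k with ⟨N, rfl | rfl⟩
  · rw [if_pos (even_two_mul N), if_pos (even_two_mul N), Nat.mul_div_cancel_left _ two_pos,
      div_pow, pow_mul]
    field_simp
  · rw [if_neg (by simp), if_neg (by simp), show (2 * N + 1 - 1) / 2 = N by omega,
      show (2 * N + 1) / 2 = N by omega, div_pow, pow_succ, pow_mul]
    field_simp

/-! ### Extension from generic points -/

/-- Off the coordinate axes and the singular lines of the hypergeometric arguments. -/
def Generic (δ x y : ℝ) : Prop :=
  x ≠ 0 ∧ y ≠ 0 ∧ y ^ 2 ≠ 1 ∧ y ^ 2 - δ ^ 2 ≠ 0 ∧ x ^ 2 - δ ^ 2 ≠ 0 ∧ y ^ 2 - x ^ 2 ≠ 0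

lemma exists_isPoly_generic (δ : ℝ) : ∃ g : ℝ → ℝ → ℝ, IsPoly g ∧ (∃ x₀ y₀, g x₀ y₀ ≠ 0) ∧
    ∀ x y, g x y ≠ 0 → Generic δ x y := by
  have hX := isPoly_fst
  have hY := isPoly_snd
  have hC := isPoly_const
  refine ⟨fun x y => x * (y * ((y ^ 2 - 1) * ((y ^ 2 - δ ^ 2) * ((x ^ 2 - δ ^ 2)
    * (y ^ 2 - x ^ 2))))), hX.mul (hY.mul (((hY.pow 2).sub (hC 1)).mul
    (((hY.pow 2).sub (hC _)).mul (((hX.pow 2).sub (hC _)).mul ((hY.pow 2).sub (hX.pow 2)))))),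
    ⟨|δ| + 3, |δ| + 2, ?_⟩, fun x y h => ?_⟩
  -- The witness has `x > y > max(1, |δ|)`, so no factor vanishes.
  · have := abs_nonneg δ
    have hs := sq_abs δ
    refine mul_ne_zero (by positivity) (mul_ne_zero (by positivity) (mul_ne_zero ?_
      (mul_ne_zero ?_ (mul_ne_zero ?_ ?_)))) <;> nlinarith
  · simp only [Generic, mul_ne_zero_iff, sub_ne_zero] at h ⊢
    exact h

lemma L1_eigen_of_generic {α β γ δ μ : ℝ} {P : MvPolynomial (Fin 2) ℝ}
    (h : ∀ x y, Generic δ x y → L1 α β γ δ (toFun P) x y = μ * toFun P x y) {x y : ℝ}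
    (hx : x ≠ 0) (hy : y ≠ 0) : L1 α β γ δ (toFun P) x y = μ * toFun P x y := by
  obtain ⟨g, hg, ⟨x₀, y₀, h₀⟩, hgen⟩ := exists_isPoly_generic δ
  have hT := isPoly_toFun P
  have h1 : IsPoly (Rx (Ry (dy (toFun P)))) := hT.dy.Ry.Rx
  have h2 : IsPoly (Ry (dy (toFun P))) := hT.dy.Ry
  have h3 : IsPoly (Rx (Ry (dx (toFun P)))) := hT.dx.Ry.Rx
  have h4 : IsPoly (Rx (dx (toFun P))) := hT.dx.Rx
  have h5 : IsPoly (Rx (Ry (toFun P))) := hT.Ry.Rx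
  have h6 : IsPoly (Rx (toFun P)) := hT.Rx
  have h7 : IsPoly (Ry (toFun P)) := hT.Ry
  have hX := isPoly_fst
  have hY := isPoly_snd
  have hC := isPoly_const
  -- This is the eigenvalue equation multiplied by `4x²y²`, the common denominator of the
  -- coefficients.
  have key := IsPoly.eq_zero_of_generic (f := fun x y =>
    2 * x * y ^ 2 * (δ + x) * (y - 1) * Rx (Ry (dy (toFun P))) x y
      + 2 * x * y * δ * (x - y) * (y - 1) * Ry (dy (toFun P)) x y
      + 2 * x ^ 2 * y * (δ + x) * (y - 1) * Rx (Ry (dx (toFun P))) x y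
      + 2 * x * y * (δ + x) * (x - y) * Rx (dx (toFun P)) x y
      + x * y * (x * (1 + β + γ - y * (α + β + γ + 2)) - δ * (y * (α + γ + 1) - γ))
        * (Rx (Ry (toFun P)) x y - toFun P x y)
      - y * (x * (x * (β + γ + 1) - β * y) + δ * (y + γ * x)) * (Rx (toFun P) x y - toFun P x y)
      - δ * x * (x + α * x * y - y * (y * (α + γ + 1) - γ)) * (Ry (toFun P) x y - toFun P x y)
      - μ * (4 * x ^ 2 * y ^ 2) * toFun P x y) ?_ hg h₀ ?_ x y
  · have e : L1 α β γ δ (toFun P) x y - μ * toFun P x y = 0 := by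
      refine (mul_eq_zero.1 (Eq.trans ?_ key)).resolve_left
        (show 4 * x ^ 2 * y ^ 2 ≠ 0 by positivity)
      simp only [L1, G1, G2, G3, G5, G6, G7, G8]
      field_simp
      ring
    exact sub_eq_zero.1 e
  · repeat' first
      | exact hX | exact hY | exact hT | exact h1 | exact h2 | exact h3 | exact h4 | exact h5
      | exact h6 | exact h7 | exact hC _ | refine IsPoly.sub ?_ ?_ | refine IsPoly.add ?_ ?_
      | refine IsPoly.pow ?_ _ | refine IsPoly.mul ?_ ?_
  · intro x y hxy
    have hxy := hgen x y hxy
    have e := sub_eq_zero.2 (h x y hxy)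
    obtain ⟨hx, hy, -⟩ := hxy
    refine Eq.trans ?_ (mul_eq_zero_of_right (4 * x ^ 2 * y ^ 2) e)
    simp only [L1, G1, G2, G3, G5, G6, G7, G8]
    field_simp
    ring

lemma L2_eigen_of_generic {β γ δ ν : ℝ} {P : MvPolynomial (Fin 2) ℝ}
    (h : ∀ x y, Generic δ x y → L2 β γ δ (toFun P) x y = ν * toFun P x y) {x : ℝ} (y : ℝ)
    (hx : x ≠ 0) : L2 β γ δ (toFun P) x y = ν * toFun P x y := by
  obtain ⟨g, hg, ⟨x₀, y₀, h₀⟩, hgen⟩ := exists_isPoly_generic δ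
  have hT := isPoly_toFun P
  have h4 : IsPoly (Rx (dx (toFun P))) := hT.dx.Rx
  have h6 : IsPoly (Rx (toFun P)) := hT.Rx
  have hX := isPoly_fst
  have hY := isPoly_snd
  have hC := isPoly_const
  have key := IsPoly.eq_zero_of_generic (f := fun x y =>
    2 * (y - x) * (x + δ) * x * Rx (dx (toFun P)) x y
      + ((γ + β + 1) * x ^ 2 + (δ * γ - β * y) * x + δ * y) * (Rx (toFun P) x y - toFun P x y)
      - ν * x ^ 2 * toFun P x y) ?_ hg h₀ ?_ x y
  · have e : L2 β γ δ (toFun P) x y - ν * toFun P x y = 0 := by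
      refine (mul_eq_zero.1 (Eq.trans ?_ key)).resolve_left (show x ^ 2 ≠ 0 by positivity)
      simp only [L2]
      field_simp
    exact sub_eq_zero.1 e
  · repeat' first
      | exact hX | exact hY | exact hT | exact h4 | exact h6 | exact hC _
      | refine IsPoly.sub ?_ ?_ | refine IsPoly.add ?_ ?_ | refine IsPoly.pow ?_ _ | refine IsPoly.mul ?_ ?_
  · intro x y hxy
    have hxy := hgen x y hxy
    have e := sub_eq_zero.2 (h x y hxy)
    obtain ⟨hx, hy, -⟩ := hxy
    refine Eq.trans ?_ (mul_eq_zero_of_right (x ^ 2) e)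
    simp only [L2]
    field_simp

end BigNegOneJacobi

/-! ### Assembly -/

open BigNegOneJacobi

theorem proposition3p1 (α β γ δ : ℝ) (hα : -1 < α) (hβ : -1 < β) (hγ : -1 < γ)
    (hδ : |δ| ≠ 1) (n k : ℕ) (hkn : k ≤ n) :
    ∃ P : MvPolynomial (Fin 2) ℝ,
      BigNegOneJacobi.IsBivariateJacobi α β γ δ n k P ∧ P ≠ 0 ∧
      (∀ x y : ℝ, x ≠ 0 → y ≠ 0 →
        BigNegOneJacobi.L1 α β γ δ (BigNegOneJacobi.toFun P) x y =
          BigNegOneJacobi.mu α β γ n * BigNegOneJacobi.toFun P x y) ∧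
      (∀ x y : ℝ, x ≠ 0 →
        BigNegOneJacobi.L2 β γ δ (BigNegOneJacobi.toFun P) x y =
          BigNegOneJacobi.nu β γ k * BigNegOneJacobi.toFun P x y) := by
  have hδ2 : δ ^ 2 ≠ 1 := fun h => hδ <|
    (pow_eq_one_iff_of_nonneg (abs_nonneg δ) two_ne_zero).1 (by rwa [sq_abs])
  have hV1 : (1 : ℝ) ^ 2 - δ ^ 2 ≠ 0 := by
    rw [one_pow]; exact sub_ne_zero.2 hδ2.symm
  obtain ⟨c, hc⟩ : ∃ c : ℝ, c = (-1) ^ k * δ := ⟨_, rfl⟩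
  have hc1 : 1 + c ≠ 0 := by
    intro h
    have hc2 : c ^ 2 = δ ^ 2 := by rw [hc, mul_pow, ← pow_mul, mul_comm k, pow_mul]; simp
    exact hδ2 (by rw [← hc2, show c = -1 by linarith]; norm_num)
  obtain ⟨p, q, hpq⟩ := exists_isFactorPair (n - k) (2 * k + β + γ + 1) hα
  obtain ⟨F, S, hFS⟩ := exists_isFactorPair k β hγ
  obtain ⟨P, hP⟩ := exists_polynomial (c := c) (δ := δ) p q hFS
  have hnu : nu β γ k = 2 * index k (γ + β + 1) := by
    by_cases hk : Even k
    · simp [nu, index, hk]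
    · simp [nu, index, hk]; ring
  refine ⟨P, fun x y hy hyd => ?_, ?_, fun x y hx hy => ?_, fun x y hx => ?_⟩
  · have hV := sub_ne_zero.2 hyd
    rw [bivariateJacobi, mul_assoc, rho_mul_bigJacobi hFS hy hV, ← hc,
      hpq.bigJacobi_eq _ _ hc1]
    exact hP x y hV
  -- At `(1, 1)` both hypergeometric arguments and both factors `1 - y`, `y - x` vanish, leaving
  -- `weight(1) (1 + δ)`, which is nonzero since `δ² ≠ 1`.
  · rintro rfl
    have h := hP 1 1 hV1
    have hw : weight δ k 1 ≠ 0 := by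
      have := add_ne_zero_of_sq hV1
      rw [weight]
      split_ifs <;> positivity
    have := add_ne_zero_of_sq hV1
    simp [toFun, univ, gPoly, zArg, hpq.eval_zero, hFS.eval_zero, hw, this] at h
  · refine L1_eigen_of_generic (fun x y h => ?_) hx hy
    obtain ⟨hx, hy, hy1, hV, hxd, hxy⟩ := h
    exact L1_generic hP hFS.contiguous hx hV hxd hxy hkn hc hpq.contiguous hδ2 hy hy1
  · rw [hnu]
    refine L2_eigen_of_generic (fun x y h => ?_) y hx
    obtain ⟨hx, -, -, hV, hxd, hxy⟩ := h
    exact L2_generic hP hFS.contiguous hx hV hxd hxy
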